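/- Let $P\subset\mathbb R^n$ be a rational polytope (a polytope all of whose vertices lie in $\mathbb Q^n$) of dimension at least $1$, and let $v\in P$ be any point. Then $P$ has finitely many facets and $$\mathrm{Vol}(P)=\sum_{F\text{ facet of }P}\mathrm{Ht}_F(v)\,\mathrm{Vol}(F).$$ Here $\mathrm{Vol}$ and $\mathrm{Ht}$ are defined as follows. For a nonempty rational polytope $Q\subset\mathbb R^n$ with affine hull $A$, choose $w\in A$ and let $L=(A-w)\cap\mathbb Z^n$, a free abelian group of rank $d=\dim Q$ with a $\mathbb Z$-basis $v_1,\dots,v_d$; the lattice normalized volume $\mathrm{Vol}(Q)$ is the measure of $Q-w$ under the Lebesgue measure on the linear space $A-w$, scaled so that the simplex $\mathrm{conv}(0,v_1,\dots,v_d)$ has measure $1$. (In particular a single point has volume $1$.) For a facet $F$ of $P$ with affine hull $H=\mathrm{aff}(F)$ and a point $x\in\mathrm{aff}(P)$, the lattice height $\mathrm{Ht}_F(x)$ is $0$ if $x\in H$. Otherwise let $A=\mathrm{aff}(\{x\}\cup H)$, choose $w\in A$, and write $H-w=\{y\in A-w:\lambda(y)=\beta\}$, where $\beta\in\mathbb R$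 and $\lambda$ is a linear form on $A-w$ that takes integer values on $(A-w)\cap\mathbb Z^n$ and takes the value $1$ there (a primitive integral form); then $\mathrm{Ht}_F(x)=|\lambda(x-w)-\beta|$. Neither definition depends on the choices made. -/

import Mathlib

open MeasureTheory

/-- A rational polytope in `ℝⁿ`: the convex hull of finitely many points, all of whose vertices
(extreme points) have rational coordinates. -/
def IsRationalPolytope {n : ℕ} (P : Set (Fin n → ℝ)) : Prop :=
  (∃ S : Set (Fin n → ℝ), S.Finite ∧ P = convexHull ℝ S) ∧
    ∀ x ∈ P.extremePoints ℝ, ∀ i, ∃ q : ℚ, x i = q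

/-- The dimension of a (nonempty) set: the dimension of its affine hull. -/
noncomputable def affDim {n : ℕ} (X : Set (Fin n → ℝ)) : ℕ :=
  Module.finrank ℝ (affineSpan ℝ X).direction

/-- The set of facets of `P`: the nonempty (exposed) faces of `P` of codimension one in `P`. -/
def facets {n : ℕ} (P : Set (Fin n → ℝ)) : Set (Set (Fin n → ℝ)) :=
  {F | F.Nonempty ∧ IsExposed ℝ P F ∧ affDim F + 1 = affDim P}

/-- The inclusion `ℤⁿ → ℝⁿ`. -/
def intVec {n : ℕ} (z : Fin n → ℤ) : Fin n → ℝ := fun i => (z i : ℝ)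

/-- The subgroup `V ∩ ℤⁿ` of `ℤⁿ`, for a linear subspace `V` of `ℝⁿ`. -/
def latticeOf {n : ℕ} (V : Submodule ℝ (Fin n → ℝ)) : Submodule ℤ (Fin n → ℤ) where
  carrier := {z | intVec z ∈ V}
  zero_mem' := by
    have h : intVec (0 : Fin n → ℤ) = 0 := by ext i; simp [intVec]
    simp only [Set.mem_ofPred_eq, h, V.zero_mem]
  add_mem' := by
    intro a b ha hb
    have h : intVec (a + b) = intVec a + intVec b := by ext i; simp [intVec]
    simp only [Set.mem_ofPred_eq, h] at *
    exact V.add_mem ha hb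
  smul_mem' := by
    intro c a ha
    have h : intVec (c • a) = (c : ℝ) • intVec a := by ext i; simp [intVec]
    simp only [Set.mem_ofPred_eq, h] at *
    exact V.smul_mem _ ha

/-- The simplex `conv(0, v₁, …, v_d)` in `V`, where `v₁, …, v_d` is a `ℤ`-basis of `V ∩ ℤⁿ`. -/
noncomputable def unimodularSimplex {n : ℕ} (V : Submodule ℝ (Fin n → ℝ)) : Set V :=
  convexHull ℝ (insert 0 (Set.range fun i =>
    (⟨intVec (Module.finBasis ℤ (latticeOf V) i : Fin n → ℤ),
      (Module.finBasis ℤ (latticeOf V) i).2⟩ : V)))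

/-- For a rational linear subspace `V` of `ℝⁿ`: the Lebesgue (i.e. Haar) measure on `V`, scaled so
that the simplex spanned by `0` and a `ℤ`-basis of `V ∩ ℤⁿ` has measure `1`. -/
noncomputable def latticeMeasure {n : ℕ} (V : Submodule ℝ (Fin n → ℝ)) : Measure V :=
  ((Measure.addHaar : Measure V) (unimodularSimplex V))⁻¹ • (Measure.addHaar : Measure V)

open Classical in
/-- The lattice normalized volume of a set `X` whose affine hull `A` is rational: the normalized
measure of the translate `X - w` inside the direction space of `A`, where `w ∈ X`. -/
noncomputable def latticeVolume {n : ℕ} (X : Set (Fin n → ℝ)) : ℝ :=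
  if h : X.Nonempty then
    (latticeMeasure (affineSpan ℝ X).direction
      {u | (u : Fin n → ℝ) + h.some ∈ X}).toReal
  else 0

/-- `r` is the lattice height of the point `x` over the affine subspace `H`. It is `0` if `x ∈ H`.
Otherwise let `A = aff(x, H)` and translate by an auxiliary point `w ∈ A`; then `H - w` is cut out
from `A - w` by an equation `φ y = β`, where the linear form `φ` takes integer values on the lattice
`(A - w) ∩ ℤⁿ` and is primitive, that is, takes the value `1` on it; and `r = |φ (x - w) - β|`.
(Only the restriction of `φ` to the linear space `A - w` matters.) -/
def IsLatticeHeight {n : ℕ} (H : AffineSubspace ℝ (Fin n → ℝ)) (x : Fin n → ℝ) (r : ℝ) : Prop :=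
  (x ∈ H ∧ r = 0) ∨
  (x ∉ H ∧ ∃ w ∈ affineSpan ℝ (insert x (H : Set (Fin n → ℝ))),
    ∃ (φ : (Fin n → ℝ) →ₗ[ℝ] ℝ) (β : ℝ),
      (∀ z ∈ latticeOf (affineSpan ℝ (insert x (H : Set (Fin n → ℝ)))).direction,
        ∃ m : ℤ, φ (intVec z) = m) ∧
      (∃ z ∈ latticeOf (affineSpan ℝ (insert x (H : Set (Fin n → ℝ)))).direction,
        φ (intVec z) = 1) ∧
      (∀ y ∈ affineSpan ℝ (insert x (H : Set (Fin n → ℝ))), y ∈ H ↔ φ (y - w) = β) ∧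
      r = |φ (x - w) - β|)

open Classical in
/-- The lattice height of the point `x` over the affine hull of `F`. -/
noncomputable def latticeHeight {n : ℕ} (F : Set (Fin n → ℝ)) (x : Fin n → ℝ) : ℝ :=
  if h : ∃ r, IsLatticeHeight (affineSpan ℝ F) x r then h.choose else 0

/-! Translate `v` to the origin of the direction space `V` of `aff P` and cut `P - v` into pyramids
with apex `0` over the translated facets. A ray from `0` through a nonzero point of `P - v` leaves
it at a point with a supporting hyperplane, so that point lies in the cone over a proper exposed
face. If the translated face spans `V`, the face has codimension one and is a facet; the finitely
many other faces only cover proper subspaces, which are null. Cones over facets through `v` are null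
too, and cones over two distinct facets avoiding `v` meet inside the proper subspace spanned by the
intersection of the translated facets. Hence `measure_slice_eq_sum`, for any Haar measure.

It remains to measure one pyramid. By `exists_measure_pyramid_eq` its measure is a constant times
that of the base. At lattice height one the constant is found by taking a unimodular simplex as
base: by `exists_adapted_basis` the pyramid is then unimodular as well, so after normalization no
dimensional factor survives. A linear map moving the apex relative to the base multiplies the volume
by the lattice height (`latticeMeasure_pyramid`). Rationality of the vertices makes the lattices of
full rank and provides the primitive forms (`exists_primitive_form`). -/

open Module

/-! ### Lattices in rational subspaces and their unimodular simplices -/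

/-- The inclusion of the lattice `V ∩ ℤⁿ` into `V`. -/
def latticeEmb {n : ℕ} (V : Submodule ℝ (Fin n → ℝ)) : latticeOf V →ₗ[ℤ] V where
  toFun z := ⟨intVec (z : Fin n → ℤ), z.2⟩
  map_add' a b := by ext i; simp [intVec]
  map_smul' c a := by ext i; simp [intVec]

theorem coe_latticeEmb {n : ℕ} (V : Submodule ℝ (Fin n → ℝ)) (z : latticeOf V) :
    (latticeEmb V z : Fin n → ℝ) = intVec (z : Fin n → ℤ) := rfl

theorem latticeEmb_injective {n : ℕ} (V : Submodule ℝ (Fin n → ℝ)) :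
    Function.Injective (latticeEmb V) := by
  intro a b h
  ext i
  have := congrFun (congrArg Subtype.val h) i
  simpa [latticeEmb, intVec] using this

/-- A linear subspace of `ℝⁿ` is rational if it is spanned by integral vectors. -/
def IsRationalSubspace {n : ℕ} (V : Submodule ℝ (Fin n → ℝ)) : Prop :=
  Submodule.span ℝ (Set.range (latticeEmb V)) = ⊤

/-- Inherited from the discreteness of `ℤⁿ` in `ℝⁿ`; this is what allows a `ℤ`-basis of the lattice
to serve as a real basis. -/
instance discreteTopology_range_latticeEmb {n : ℕ} (V : Submodule ℝ (Fin n → ℝ)) :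
    DiscreteTopology (LinearMap.range (latticeEmb V)) := by
  have hmem : ∀ x : LinearMap.range (latticeEmb V),
      ((x : V) : Fin n → ℝ) ∈ Submodule.span ℤ (Set.range (Pi.basisFun ℝ (Fin n))) := by
    rintro ⟨_, z, rfl⟩
    rw [Basis.mem_span_iff_repr_mem]
    intro i
    exact ⟨(z : Fin n → ℤ) i, by simp [latticeEmb, intVec]⟩
  refine DiscreteTopology.of_continuous_injective
    (f := fun x => (⟨_, hmem x⟩ : Submodule.span ℤ (Set.range (Pi.basisFun ℝ (Fin n))))) ?_ ?_
  · fun_prop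
  · intro a b h
    exact Subtype.ext (Subtype.ext (Subtype.mk.inj h))

/-- A `ℤ`-basis of the lattice of a rational subspace, as a real basis of that subspace. -/
noncomputable def IsRationalSubspace.realBasis {n : ℕ} {V : Submodule ℝ (Fin n → ℝ)}
    (hV : IsRationalSubspace V) {ι : Type*} (b : Basis ι ℤ (latticeOf V)) : Basis ι ℝ V :=
  haveI : IsZLattice ℝ (LinearMap.range (latticeEmb V)) := ⟨by rw [LinearMap.coe_range]; exact hV⟩
  (b.map (LinearEquiv.ofInjective _ (latticeEmb_injective V))).ofZLatticeBasis ℝ _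

theorem IsRationalSubspace.realBasis_apply {n : ℕ} {V : Submodule ℝ (Fin n → ℝ)}
    (hV : IsRationalSubspace V) {ι : Type*} (b : Basis ι ℤ (latticeOf V)) (i : ι) :
    hV.realBasis b i = latticeEmb V (b i) := by
  simp [IsRationalSubspace.realBasis]

theorem IsRationalSubspace.finrank_latticeOf {n : ℕ} {V : Submodule ℝ (Fin n → ℝ)}
    (hV : IsRationalSubspace V) : finrank ℤ (latticeOf V) = finrank ℝ V := by
  let b := Module.finBasis ℤ (latticeOf V)
  simp [finrank_eq_card_basis (hV.realBasis b)]

theorem IsRationalSubspace.realBasis_repr {n : ℕ} {V : Submodule ℝ (Fin n → ℝ)}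
    (hV : IsRationalSubspace V) {ι : Type*} (b : Basis ι ℤ (latticeOf V)) (z : latticeOf V)
    (i : ι) : (hV.realBasis b).repr (latticeEmb V z) i = b.repr z i := by
  have : IsZLattice ℝ (LinearMap.range (latticeEmb V)) :=
    ⟨by rw [LinearMap.coe_range]; exact hV⟩
  have := (b.map (LinearEquiv.ofInjective _ (latticeEmb_injective V))).ofZLatticeBasis_repr_apply ℝ
    _ ((LinearEquiv.ofInjective _ (latticeEmb_injective V)) z) i
  simpa [IsRationalSubspace.realBasis] using this

/-- The simplex with vertices `0` and the given family of lattice vectors. -/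
def latticeSimplex {n : ℕ} {V : Submodule ℝ (Fin n → ℝ)} {ι : Type*} (b : ι → latticeOf V) :
    Set V :=
  convexHull ℝ (insert 0 (Set.range fun i => latticeEmb V (b i)))

theorem unimodularSimplex_eq {n : ℕ} (V : Submodule ℝ (Fin n → ℝ)) :
    unimodularSimplex V = latticeSimplex (Module.finBasis ℤ (latticeOf V)) := rfl

/-- The volume of a unimodular simplex does not depend on the choice of the lattice basis. -/
theorem IsRationalSubspace.measure_latticeSimplex_eq {n : ℕ} {V : Submodule ℝ (Fin n → ℝ)}
    (hV : IsRationalSubspace V) (μ : Measure V) [μ.IsAddHaarMeasure] {ι κ : Type*} [Finite ι]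
    (b : Basis ι ℤ (latticeOf V)) (c : Basis κ ℤ (latticeOf V)) :
    μ (latticeSimplex b) = μ (latticeSimplex c) := by
  classical
  cases nonempty_fintype ι
  have key : ∀ c : Basis ι ℤ (latticeOf V), μ (latticeSimplex b) = μ (latticeSimplex c) := by
    intro c
    -- The change of basis has an invertible integer matrix, so its determinant is `±1` and it
    -- preserves `μ`.
    let e : V →ₗ[ℝ] V := (hV.realBasis b).constr ℝ (hV.realBasis c)
    have he : ∀ i, e (latticeEmb V (b i)) = latticeEmb V (c i) := by
      intro i
      rw [← hV.realBasis_apply, ← hV.realBasis_apply, Basis.constr_basis]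
    have himg : latticeSimplex c = e '' latticeSimplex b := by
      rw [latticeSimplex, latticeSimplex, LinearMap.image_convexHull, Set.image_insert_eq,
        map_zero, ← Set.range_comp]
      congr 3
      ext i
      simp [he]
    have hmat : LinearMap.toMatrix (hV.realBasis b) (hV.realBasis b) e
        = (b.toMatrix c).map (Int.castRingHom ℝ) := by
      ext i j
      rw [LinearMap.toMatrix_apply, hV.realBasis_apply, he, hV.realBasis_repr]
      simp [Basis.toMatrix_apply]
    have hdet : |LinearMap.det e| = 1 := by
      rw [← LinearMap.det_toMatrix (hV.realBasis b), hmat, ← RingHom.mapMatrix_apply,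
        ← RingHom.map_det]
      have hu : IsUnit (b.toMatrix c).det := by
        rw [← Basis.det_apply]
        exact Basis.isUnit_det b c
      rcases Int.isUnit_iff.1 hu with h | h <;> simp [h]
    rw [himg, Measure.addHaar_image_linearMap, hdet]
    simp
  rw [key (c.reindex (c.indexEquiv b))]
  congr 1
  unfold latticeSimplex
  congr 2
  ext x
  simp only [Set.mem_range, Basis.reindex_apply]
  exact (c.indexEquiv b).symm.surjective.exists (p := fun i => latticeEmb V (c i) = x) |>.symm

/-- Keeps the normalizing factor of `latticeMeasure` finite, since the inverse of `0` in `ENNReal`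
is `⊤`. -/
theorem IsRationalSubspace.measure_unimodularSimplex_ne_zero {n : ℕ}
    {V : Submodule ℝ (Fin n → ℝ)} (hV : IsRationalSubspace V) (μ : Measure V)
    [μ.IsAddHaarMeasure] : μ (unimodularSimplex V) ≠ 0 := by
  have hint : (interior (unimodularSimplex V)).Nonempty := by
    rw [unimodularSimplex_eq, latticeSimplex, interior_convexHull_nonempty_iff_affineSpan_eq_top,
      AffineSubspace.affineSpan_eq_top_iff_vectorSpan_eq_top_of_nonempty _ _ _
        (Set.insert_nonempty _ _),
      vectorSpan_eq_span_vsub_set_right ℝ (Set.mem_insert 0 _), eq_top_iff,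
      ← (hV.realBasis (Module.finBasis ℤ (latticeOf V))).span_eq]
    apply Submodule.span_mono
    rintro _ ⟨i, rfl⟩
    exact ⟨_, Set.mem_insert_of_mem _ ⟨i, rfl⟩, by simp [hV.realBasis_apply]⟩
  exact (Measure.measure_pos_of_nonempty_interior μ hint).ne'

/-- The linear span of finitely many rational vectors is a rational subspace. -/
theorem isRationalSubspace_span {n : ℕ} {S : Set (Fin n → ℝ)}
    (hS : ∀ x ∈ S, ∀ i, ∃ q : ℚ, x i = q) : IsRationalSubspace (Submodule.span ℝ S) := by
  set V := Submodule.span ℝ S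
  have key : V ≤ (Submodule.span ℝ (Set.range (latticeEmb V))).map V.subtype := by
    refine Submodule.span_le.2 fun x hx => ?_
    choose q hq using hS x hx
    -- A common denominator: `N • x` is integral and spans the same line as `x`.
    let N : ℕ := ∏ i, (q i).den
    have hN : (N : ℝ) ≠ 0 := by
      simp [N, Finset.prod_ne_zero_iff]
    have hint : ∀ i, ∃ m : ℤ, (N : ℝ) * x i = m := by
      intro i
      refine ⟨(∏ j ∈ Finset.univ.erase i, ((q j).den : ℤ)) * (q i).num, ?_⟩
      have h1 : N = (∏ j ∈ Finset.univ.erase i, (q j).den) * (q i).den :=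
        (Finset.prod_erase_mul _ _ (Finset.mem_univ i)).symm
      have h2 : ((q i).den : ℝ) * (q i : ℝ) = (q i).num := by
        exact_mod_cast Rat.den_mul_eq_num (q i)
      rw [h1, hq i]
      push_cast
      rw [mul_assoc, h2]
    choose m hm using hint
    have hmx : intVec m = (N : ℝ) • x := by
      ext i
      simp [intVec, hm]
    have hmV : m ∈ latticeOf V := by
      change intVec m ∈ V
      rw [hmx]
      exact V.smul_mem _ (Submodule.subset_span hx)
    refine ⟨(N : ℝ)⁻¹ • latticeEmb V ⟨m, hmV⟩,
      Submodule.smul_mem _ _ (Submodule.subset_span ⟨_, rfl⟩), ?_⟩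
    simp [coe_latticeEmb, hmx, smul_smul, hN]
  rw [IsRationalSubspace, eq_top_iff]
  rintro ⟨x, hx⟩ -
  obtain ⟨y, hy, hyx⟩ := key hx
  have : y = ⟨x, hx⟩ := Subtype.ext hyx
  exact this ▸ hy

theorem isRationalSubspace_vectorSpan {n : ℕ} {S : Set (Fin n → ℝ)}
    (hS : ∀ x ∈ S, ∀ i, ∃ q : ℚ, x i = q) : IsRationalSubspace (vectorSpan ℝ S) := by
  refine isRationalSubspace_span ?_
  rintro _ ⟨x, hx, y, hy, rfl⟩ i
  obtain ⟨p, hp⟩ := hS x hx i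
  obtain ⟨q, hq⟩ := hS y hy i
  exact ⟨p - q, by simp [hp, hq]⟩

/-! ### Cones and the Haar measure of a pyramid -/

/-- The union of the segments joining `0` to the points of `X`. -/
def coneOver {E : Type*} [AddCommGroup E] [Module ℝ E] (X : Set E) : Set E :=
  {u | ∃ t ∈ Set.Icc (0 : ℝ) 1, ∃ x ∈ X, t • x = u}

section Cone

variable {E : Type*} [AddCommGroup E] [Module ℝ E]

theorem image_coneOver {F : Type*} [AddCommGroup F] [Module ℝ F] (f : E →ₗ[ℝ] F) (X : Set E) :
    f '' coneOver X = coneOver (f '' X) := by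
  ext y
  constructor
  · rintro ⟨_, ⟨t, ht, x, hx, rfl⟩, rfl⟩
    exact ⟨t, ht, f x, ⟨x, hx, rfl⟩, by simp⟩
  · rintro ⟨t, ht, _, ⟨x, hx, rfl⟩, rfl⟩
    exact ⟨t • x, ⟨t, ht, x, hx, rfl⟩, by simp⟩

theorem isCompact_coneOver [TopologicalSpace E] [ContinuousSMul ℝ E] {X : Set E}
    (hX : IsCompact X) : IsCompact (coneOver X) := by
  have h : coneOver X = (fun p : ℝ × E => p.1 • p.2) '' (Set.Icc (0 : ℝ) 1 ×ˢ X) := by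
    ext u
    simp only [coneOver, Set.mem_ofPred_eq, Set.mem_image, Set.mem_prod, Prod.exists]
    grind
  rw [h]
  exact (isCompact_Icc.prod hX).image (by fun_prop)

theorem convexHull_insert_zero {X : Set E} (hX : X.Nonempty) :
    convexHull ℝ (insert 0 X) = coneOver (convexHull ℝ X) := by
  rw [convexHull_insert hX]
  ext u
  simp only [convexJoin_singleton_left, Set.mem_iUnion, coneOver, Set.mem_ofPred_eq,
    segment_eq_image, smul_zero, zero_add, Set.mem_image, exists_prop]
  constructor
  · rintro ⟨x, hx, t, ht, rfl⟩
    exact ⟨t, ht, x, hx, rfl⟩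
  · rintro ⟨t, ht, x, hx, rfl⟩
    exact ⟨x, hx, t, ht, rfl⟩

theorem coneOver_subset {X K : Set E} (hK : Convex ℝ K) (h0 : 0 ∈ K) (hX : X ⊆ K) :
    coneOver X ⊆ K := by
  rintro _ ⟨t, ht, x, hx, rfl⟩
  exact hK.smul_mem_of_zero_mem h0 (hX hx) ht

end Cone

/-- The volume of a pyramid is proportional to the volume of its base. -/
theorem exists_measure_pyramid_eq {E W : Type*} [NormedAddCommGroup E] [NormedSpace ℝ E]
    [MeasurableSpace E] [BorelSpace E] [NormedAddCommGroup W]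
    [NormedSpace ℝ W] [FiniteDimensional ℝ W] [MeasurableSpace W] [BorelSpace W]
    (T : (ℝ × W) ≃L[ℝ] E) (μ : Measure E) [μ.IsAddHaarMeasure] (ν : Measure W)
    [ν.IsAddHaarMeasure] :
    ∃ c : ENNReal, c ≠ 0 ∧ c ≠ ⊤ ∧ ∀ G : Set W, IsCompact G →
      μ (coneOver ((fun g => T (1, g)) '' G)) = c * ν G := by
  have : (μ.map T.symm).IsAddHaarMeasure := T.symm.isAddHaarMeasure_map μ
  set ρ : Measure (ℝ × W) := (volume : Measure ℝ).prod ν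
  set k := (μ.map T.symm).addHaarScalarFactor ρ
  have hk : μ.map T.symm = k • ρ := Measure.isAddLeftInvariant_eq_smul _ _
  have hk0 : k ≠ 0 := (Measure.addHaarScalarFactor_pos_of_isAddHaarMeasure _ _).ne'
  -- By slicing, this is the ratio of pyramid to base for the product measure. Its value is
  -- irrelevant, as it cancels under normalization; only `c₁ ≠ 0` and `c₁ ≠ ⊤` matter.
  set c₁ : ENNReal := ∫⁻ t in Set.Icc (0 : ℝ) 1, ENNReal.ofReal |t ^ finrank ℝ W|
  have hc_top : c₁ ≠ ⊤ := by
    have h : c₁ ≤ ∫⁻ _ in Set.Icc (0 : ℝ) 1, 1 := by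
      refine setLIntegral_mono measurable_const fun t ht => ?_
      rw [ENNReal.ofReal_le_one, abs_pow, abs_of_nonneg ht.1]
      exact pow_le_one₀ ht.1 ht.2
    exact ne_top_of_le_ne_top (by simp) h
  have hc_zero : c₁ ≠ 0 := by
    have h : ∫⁻ _ in Set.Icc (1 / 2 : ℝ) 1, ENNReal.ofReal ((1 / 2) ^ finrank ℝ W) ≤ c₁ := by
      refine le_trans (setLIntegral_mono' measurableSet_Icc fun t ht => ?_)
        (lintegral_mono_set (Set.Icc_subset_Icc_left (by norm_num : (0 : ℝ) ≤ 1 / 2)))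
      apply ENNReal.ofReal_le_ofReal
      rw [abs_pow]
      gcongr
      exact ht.1.trans (le_abs_self t)
    refine (lt_of_lt_of_le ?_ h).ne'
    rw [setLIntegral_const]
    refine ENNReal.mul_pos ?_ ?_
    · simp
    · rw [Real.volume_Icc]
      norm_num
  refine ⟨k * c₁, mul_ne_zero (by exact_mod_cast hk0) hc_zero,
    ENNReal.mul_ne_top ENNReal.coe_ne_top hc_top, fun G hG => ?_⟩
  set A : Set (ℝ × W) := coneOver ((fun g => ((1 : ℝ), g)) '' G)
  have hA : IsCompact A := isCompact_coneOver (hG.image (by fun_prop))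
  have hTA : coneOver ((fun g => T (1, g)) '' G) = T.symm ⁻¹' A := by
    rw [← T.image_eq_preimage_symm]
    have := image_coneOver (T : (ℝ × W) →ₗ[ℝ] E) ((fun g => ((1 : ℝ), g)) '' G)
    simp only [Set.image_image] at this
    exact this.symm
  have hslice : ∀ t, ν (Prod.mk t ⁻¹' A)
      = (Set.Icc (0 : ℝ) 1).indicator (fun t => ENNReal.ofReal |t ^ finrank ℝ W| * ν G) t := by
    intro t
    by_cases ht : t ∈ Set.Icc (0 : ℝ) 1
    -- The slice at height `t` is `t • G`, so its measure scales by `|t ^ dim W|`.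
    · rw [Set.indicator_of_mem ht, ← Measure.addHaar_smul]
      congr 1
      ext w
      simp only [A, coneOver, Set.mem_preimage, Set.mem_ofPred_eq, Set.mem_image,
        Set.mem_smul_set]
      constructor
      · rintro ⟨s, hs, _, ⟨g, hg, rfl⟩, h⟩
        simp only [Prod.smul_mk, smul_eq_mul, mul_one, Prod.mk.injEq] at h
        exact ⟨g, hg, h.1 ▸ h.2⟩
      · rintro ⟨g, hg, rfl⟩
        exact ⟨t, ht, _, ⟨g, hg, rfl⟩, by simp⟩
    · rw [Set.indicator_of_notMem ht]
      have : Prod.mk t ⁻¹' A = ∅ := by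
        rw [Set.eq_empty_iff_forall_notMem]
        rintro w ⟨s, hs, _, ⟨g, hg, rfl⟩, h⟩
        simp only [Prod.smul_mk, smul_eq_mul, mul_one, Prod.mk.injEq] at h
        exact ht (h.1 ▸ hs)
      rw [this, measure_empty]
  rw [hTA, ← Measure.map_apply T.symm.continuous.measurable hA.measurableSet, hk,
    Measure.smul_apply, Measure.prod_apply hA.measurableSet, lintegral_congr hslice,
    lintegral_indicator measurableSet_Icc, lintegral_mul_const _ (by fun_prop)]
  rw [ENNReal.smul_def, smul_eq_mul, mul_assoc]

/-! ### Lattice volume of pyramids -/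

section Pyramid

variable {n : ℕ} {V W : Submodule ℝ (Fin n → ℝ)}

theorem latticeOf_mono (h : W ≤ V) : latticeOf W ≤ latticeOf V := fun _ hz => h hz

/-- If `W` is the kernel in `V` of a linear form which is integral on the lattice of `V` and takes
the value `1` at the lattice vector `z₀`, then the lattice of `V` has a basis consisting of `z₀`
and the translates by `z₀` of a basis of the lattice of `W`. -/
theorem exists_adapted_basis (hWV : W ≤ V) (φ : (Fin n → ℝ) →ₗ[ℝ] ℝ)
    (hφ : ∀ z ∈ latticeOf V, ∃ m : ℤ, φ (intVec z) = m) (z₀ : latticeOf V)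
    (hz₀ : φ (intVec z₀) = 1) (hW : ∀ y ∈ V, y ∈ W ↔ φ y = 0) {ι : Type*}
    (b : Basis ι ℤ (latticeOf W)) :
    ∃ c : Basis (Unit ⊕ ι) ℤ (latticeOf V), c (Sum.inl ()) = z₀ ∧
      ∀ i, c (Sum.inr i) = z₀ + Submodule.inclusion (latticeOf_mono hWV) (b i) := by
  let incl := Submodule.inclusion (latticeOf_mono hWV)
  -- With `s` equal to `1` on every basis vector, `f` sends `(0, b i)` to `z₀ + b i`, placing all
  -- vertices at height one.
  let s : latticeOf W →ₗ[ℤ] ℤ := b.constr ℤ (fun _ => (1 : ℤ))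
  let f : (ℤ × latticeOf W) →ₗ[ℤ] latticeOf V :=
    (LinearMap.toSpanSingleton ℤ _ z₀).comp
      (LinearMap.fst ℤ ℤ (latticeOf W) + s.comp (LinearMap.snd ℤ ℤ (latticeOf W)))
      + incl.comp (LinearMap.snd ℤ ℤ (latticeOf W))
  have hf : ∀ p, f p = (p.1 + s p.2) • z₀ + incl p.2 := fun p => rfl
  let ψ : latticeOf V →ₗ[ℤ] ℝ :=
    (φ.restrictScalars ℤ).comp ((V.subtype.restrictScalars ℤ).comp (latticeEmb V))
  have hψ : ∀ z, ψ z = φ (intVec z) := fun z => rfl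
  have hψf : ∀ p, ψ (f p) = (p.1 + s p.2 : ℤ) := by
    intro p
    have h0 : ψ (incl p.2) = 0 := (hW _ (hWV p.2.2)).1 p.2.2
    rw [hf, map_add, map_smul, h0, hψ, hz₀]
    simp
  have hbij : Function.Bijective f := by
    constructor
    · rw [← LinearMap.ker_eq_bot, LinearMap.ker_eq_bot']
      intro p hp
      have h1 : p.1 + s p.2 = 0 := by
        have := hψf p
        rw [hp, map_zero] at this
        exact_mod_cast this.symm
      rw [hf, h1, zero_smul, zero_add] at hp
      have h2 : p.2 = 0 := Submodule.inclusion_injective _ (hp.trans (map_zero _).symm)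
      rw [h2, map_zero, add_zero] at h1
      exact Prod.ext h1 h2
    · intro z
      obtain ⟨m, hm⟩ := hφ z z.2
      have hw : ((z - m • z₀ : latticeOf V) : Fin n → ℤ) ∈ latticeOf W := by
        refine (hW _ (z - m • z₀).2).2 ?_
        rw [← hψ, map_sub, map_smul, hψ, hψ, hm, hz₀]
        simp
      refine ⟨(m - s ⟨_, hw⟩, ⟨_, hw⟩), ?_⟩
      rw [hf]
      apply Subtype.ext
      simp [incl]
  let e := LinearEquiv.ofBijective f hbij
  refine ⟨((Basis.singleton Unit ℤ).prod b).map e, ?_, fun i => ?_⟩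
  · rw [Basis.map_apply]
    change f _ = _
    rw [hf]
    simp
  · rw [Basis.map_apply]
    change f _ = _
    rw [hf]
    simp [s, incl]

theorem isCompact_latticeSimplex {ι : Type*} [Finite ι] (b : ι → latticeOf V) :
    IsCompact (latticeSimplex b) :=
  ((Set.finite_range _).insert 0).isCompact_convexHull (𝕜 := ℝ)

/-- The volume of a lattice pyramid of height one is the volume of its base. -/
theorem IsRationalSubspace.latticeMeasure_pyramid_one (hV : IsRationalSubspace V) (hWV : W ≤ V)
    (φ : (Fin n → ℝ) →ₗ[ℝ] ℝ)
    (hφ : ∀ z ∈ latticeOf V, ∃ m : ℤ, φ (intVec z) = m) (z₀ : latticeOf V)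
    (hz₀ : φ (intVec z₀) = 1) (hW : ∀ y ∈ V, y ∈ W ↔ φ y = 0) {G : Set W} (hG : IsCompact G) :
    latticeMeasure V (coneOver ((fun g => latticeEmb V z₀ + Submodule.inclusion hWV g) '' G))
      = latticeMeasure W G := by
  let f : (ℝ × W) →ₗ[ℝ] V :=
    (LinearMap.toSpanSingleton ℝ _ (latticeEmb V z₀)).comp (LinearMap.fst ℝ ℝ W)
      + (Submodule.inclusion hWV).comp (LinearMap.snd ℝ ℝ W)
  have hf : ∀ p, f p = p.1 • latticeEmb V z₀ + Submodule.inclusion hWV p.2 := fun p => rfl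
  have hφf : ∀ p, φ (f p) = p.1 := by
    intro p
    have h0 : φ p.2 = 0 := (hW _ (hWV p.2.2)).1 p.2.2
    rw [hf]
    simp [coe_latticeEmb, hz₀, h0]
  have hbij : Function.Bijective f := by
    constructor
    · rw [← LinearMap.ker_eq_bot, LinearMap.ker_eq_bot']
      intro p hp
      have h1 : p.1 = 0 := by
        rw [← hφf, hp]
        simp
      rw [hf, h1, zero_smul, zero_add] at hp
      have h2 : p.2 = 0 := Submodule.inclusion_injective _ (hp.trans (map_zero _).symm)
      exact Prod.ext h1 h2
    · intro u
      have hw : ((u - φ u • latticeEmb V z₀ : V) : Fin n → ℝ) ∈ W := by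
        refine (hW _ (Subtype.mem _)).2 ?_
        simp [coe_latticeEmb, hz₀]
      refine ⟨(φ u, ⟨_, hw⟩), ?_⟩
      rw [hf]
      apply Subtype.ext
      simp
  let T : (ℝ × W) ≃L[ℝ] V := (LinearEquiv.ofBijective f hbij).toContinuousLinearEquiv
  have hT : ∀ g, T (1, g) = latticeEmb V z₀ + Submodule.inclusion hWV g := by
    intro g
    change f _ = _
    simp [hf]
  obtain ⟨c, hc0, hctop, hc⟩ := exists_measure_pyramid_eq T (Measure.addHaar : Measure V)
    (Measure.addHaar : Measure W)
  simp only [hT] at hc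
  let b := Module.finBasis ℤ (latticeOf W)
  obtain ⟨b', hb'0, hb'⟩ := exists_adapted_basis hWV φ hφ z₀ hz₀ hW b
  have hsimplex : latticeSimplex b' = coneOver
      ((fun g => latticeEmb V z₀ + Submodule.inclusion hWV g) '' unimodularSimplex W) := by
    let a : W →ᵃ[ℝ] V :=
      (AffineMap.const ℝ W (latticeEmb V z₀)) + (Submodule.inclusion hWV).toAffineMap
    have ha : ∀ g, a g = latticeEmb V z₀ + Submodule.inclusion hWV g := fun g => rfl
    rw [latticeSimplex, convexHull_insert_zero (Set.range_nonempty _)]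
    simp only [← ha]
    rw [unimodularSimplex_eq, latticeSimplex, AffineMap.image_convexHull]
    congr 2
    ext x
    simp only [Set.mem_range, Sum.exists, Set.mem_image, Set.mem_insert_iff, exists_eq_or_imp,
      hb'0, hb', ha, map_add]
    simp only [exists_const, map_zero, add_zero, exists_exists_eq_and]
    rfl
  -- Applying the same constant `c` to the base `unimodularSimplex W` shows that `c` is the ratio of
  -- the two normalizations, so it cancels.
  have hVsimplex : (Measure.addHaar : Measure V) (unimodularSimplex V)
      = c * (Measure.addHaar : Measure W) (unimodularSimplex W) := by
    rw [unimodularSimplex_eq, hV.measure_latticeSimplex_eq _ _ b', hsimplex, hc]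
    rw [unimodularSimplex_eq]
    exact isCompact_latticeSimplex _
  rw [latticeMeasure, latticeMeasure, Measure.smul_apply, Measure.smul_apply, hc G hG, hVsimplex,
    smul_eq_mul, smul_eq_mul, mul_comm, ← ENNReal.div_eq_inv_mul, ← div_eq_mul_inv,
    ENNReal.mul_div_mul_left _ _ hc0 hctop]

/-- The volume of a lattice pyramid is its lattice height times the volume of its base. -/
theorem IsRationalSubspace.latticeMeasure_pyramid (hV : IsRationalSubspace V) (hWV : W ≤ V)
    (φ : (Fin n → ℝ) →ₗ[ℝ] ℝ)
    (hφ : ∀ z ∈ latticeOf V, ∃ m : ℤ, φ (intVec z) = m) (z₀ : latticeOf V)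
    (hz₀ : φ (intVec z₀) = 1) (hW : ∀ y ∈ V, y ∈ W ↔ φ y = 0) {G : Set W} (hG : IsCompact G)
    (a : V) :
    latticeMeasure V (coneOver ((fun g => a + Submodule.inclusion hWV g) '' G))
      = ENNReal.ofReal |φ a| * latticeMeasure W G := by
  -- `D x = x + φ x • (a - z₀)` fixes `W` and sends `z₀` to `a`; its determinant is `1 + φ (a - z₀)
  -- = φ a`. The case `φ a = 0` needs no separate treatment.
  let D : V →ₗ[ℝ] V := LinearMap.transvection (φ.comp V.subtype) (a - latticeEmb V z₀)
  have hdet : LinearMap.det D = φ a := by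
    simp [D, coe_latticeEmb, hz₀]
  have hD : ∀ g : W, D (latticeEmb V z₀ + Submodule.inclusion hWV g)
      = a + Submodule.inclusion hWV g := by
    intro g
    have h0 : φ g = 0 := (hW _ (hWV g.2)).1 g.2
    simp [D, LinearMap.transvection.apply, coe_latticeEmb, hz₀, h0]
    abel
  rw [← hV.latticeMeasure_pyramid_one hWV φ hφ z₀ hz₀ hW hG]
  have himg : coneOver ((fun g => a + Submodule.inclusion hWV g) '' G) =
      D '' coneOver ((fun g => latticeEmb V z₀ + Submodule.inclusion hWV g) '' G) := by
    rw [image_coneOver, Set.image_image]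
    simp only [hD]
  rw [himg, latticeMeasure, Measure.smul_apply, Measure.smul_apply,
    Measure.addHaar_image_linearMap, hdet, smul_eq_mul, smul_eq_mul]
  ring

end Pyramid

/-! ### Supporting hyperplanes and exposed faces -/

/-- Every nonzero point of a convex body containing the origin lies on a segment from the origin to
a point of a proper exposed face. -/
theorem exists_supporting_functional_of_mem {E : Type*} [NormedAddCommGroup E] [NormedSpace ℝ E]
    {K : Set E} (hK : IsCompact K) (hconv : Convex ℝ K)
    (hint : (interior K).Nonempty) {u : E} (hu : u ∈ K) (hu0 : u ≠ 0) :
    ∃ f : StrongDual ℝ E, ∃ p ∈ K, ∃ t ∈ Set.Icc (0 : ℝ) 1, t • p = u ∧ (∀ y ∈ K, f y ≤ f p) ∧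
      ∃ y ∈ K, f y < f p := by
  -- The largest `T` in `R` marks the exit point `T • u` of the ray, which is not interior and so
  -- can be separated from the interior.
  set R : Set ℝ := (fun t : ℝ => t • u) ⁻¹' K
  have hR : IsCompact R := (isClosedEmbedding_smul_left hu0).isCompact_preimage hK
  have h1R : (1 : ℝ) ∈ R := by simpa [R] using hu
  obtain ⟨T, hTR, hTmax⟩ := hR.exists_isGreatest ⟨1, h1R⟩
  have hT1 : 1 ≤ T := hTmax h1R
  have hT0 : T ≠ 0 := by positivity
  have hnot : T • u ∉ interior K := by
    intro hmem
    have hev : ∀ᶠ t in nhds T, t • u ∈ interior K :=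
      (by fun_prop : Continuous fun t : ℝ => t • u).continuousAt.eventually
        (isOpen_interior.mem_nhds hmem)
    obtain ⟨t, ht, hTt⟩ := (hev.filter_mono nhdsWithin_le_nhds |>.and
      (self_mem_nhdsWithin (s := Set.Ioi T))).exists
    exact absurd (hTmax (interior_subset ht : t • u ∈ K)) (not_le.2 hTt)
  obtain ⟨f, hf⟩ := geometric_hahn_banach_open_point hconv.interior isOpen_interior hnot
  refine ⟨f, T • u, hTR, T⁻¹, ⟨by positivity, inv_le_one_of_one_le₀ hT1⟩, ?_, fun y hy => ?_, ?_⟩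
  · rw [smul_smul, inv_mul_cancel₀ hT0, one_smul]
  · have hcl : y ∈ closure (interior K) := by
      rw [hconv.closure_interior_eq_closure_of_nonempty_interior hint]
      exact subset_closure hy
    exact closure_minimal (fun x hx => (hf x hx).le)
      (isClosed_le f.continuous continuous_const) hcl
  · obtain ⟨y, hy⟩ := hint
    exact ⟨y, interior_subset hy, hf y hy⟩

section Faces

variable {E : Type*} [NormedAddCommGroup E] [NormedSpace ℝ E]

/-- A polytope is the convex hull of its extreme points. -/
theorem convexHull_extremePoints_of_finite {P : Set E} (hP : IsCompact P) (hconv : Convex ℝ P)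
    (hfin : (P.extremePoints ℝ).Finite) : convexHull ℝ (P.extremePoints ℝ) = P := by
  rw [← (hfin.isCompact_convexHull (𝕜 := ℝ)).isClosed.closure_eq,
    closure_convexHull_extremePoints hP hconv]

theorem IsExposed.convexHull_extremePoints {P F : Set E} (hP : IsCompact P)
    (hconv : Convex ℝ P) (hfin : (P.extremePoints ℝ).Finite) (hF : IsExposed ℝ P F) :
    convexHull ℝ (F ∩ P.extremePoints ℝ) = F := by
  have h := hF.isExtreme.extremePoints_eq
  rw [← h]
  refine convexHull_extremePoints_of_finite (hF.isCompact hP) (hF.convex hconv) ?_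
  rw [h]
  exact hfin.inter_of_right _

/-- An exposed face is determined by the extreme points of `P` that it contains. -/
theorem finite_setOf_isExposed {P : Set E} (hP : IsCompact P) (hconv : Convex ℝ P)
    (hfin : (P.extremePoints ℝ).Finite) : {F | IsExposed ℝ P F}.Finite := by
  refine (hfin.powerset.image (fun S => convexHull ℝ S)).subset fun F hF => ?_
  exact ⟨F ∩ P.extremePoints ℝ, Set.inter_subset_right,
    hF.convexHull_extremePoints hP hconv hfin⟩

theorem vectorSpan_le_ker {F : Set E} (l : E →ₗ[ℝ] ℝ) (h : ∀ x ∈ F, ∀ y ∈ F, l x = l y) :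
    vectorSpan ℝ F ≤ LinearMap.ker l := by
  refine Submodule.span_le.2 ?_
  rintro _ ⟨x, hx, y, hy, rfl⟩
  simp [h x hx y hy]

/-- An exposed face is the intersection of the polytope with the affine hull of the face. -/
theorem IsExposed.mem_iff_sub_mem_vectorSpan {P F : Set E} (hF : IsExposed ℝ P F) {p x : E}
    (hp : p ∈ F) (hx : x ∈ P) : x ∈ F ↔ x - p ∈ vectorSpan ℝ F := by
  refine ⟨fun h => vsub_mem_vectorSpan ℝ h hp, fun h => ?_⟩
  obtain ⟨l, rfl⟩ := hF ⟨p, hp⟩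
  have hker := vectorSpan_le_ker (F := {x ∈ P | ∀ y ∈ P, l y ≤ l x}) (l : E →ₗ[ℝ] ℝ)
    (fun x hx y hy => le_antisymm (hy.2 x hx.1) (hx.2 y hy.1)) h
  have hl : l x = l p := by
    simpa [sub_eq_zero] using hker
  exact ⟨hx, fun y hy => hl ▸ hp.2 y hy⟩

/-- An exposed face not containing `v` is strictly higher than `v`. -/
theorem IsExposed.exists_functional_lt {P F : Set E} (hF : IsExposed ℝ P F) (hne : F.Nonempty)
    {v : E} (hv : v ∈ P) (hvF : v ∉ F) :
    ∃ l : StrongDual ℝ E, ∀ f ∈ F, l v < l f ∧ ∀ y ∈ P, l y ≤ l f := by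
  obtain ⟨l, rfl⟩ := hF hne
  refine ⟨l, fun f hf => ⟨?_, hf.2⟩⟩
  by_contra! h
  exact hvF ⟨hv, fun y hy => (hf.2 y hy).trans h⟩

end Faces

/-! ### Decomposition of the polytope into pyramids over its facets -/

section Slice

variable {n : ℕ}

/-- The translate `X - v`, as a subset of the linear subspace `V`. -/
def slice (V : Submodule ℝ (Fin n → ℝ)) (v : Fin n → ℝ) (X : Set (Fin n → ℝ)) : Set V :=
  {u | (u : Fin n → ℝ) + v ∈ X}

theorem isCompact_slice (V : Submodule ℝ (Fin n → ℝ)) (v : Fin n → ℝ) {X : Set (Fin n → ℝ)}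
    (hX : IsCompact X) : IsCompact (slice V v X) := by
  have h : Topology.IsClosedEmbedding (fun u : V => (u : Fin n → ℝ) + v) :=
    (Homeomorph.addRight v).isClosedEmbedding.comp
      (Submodule.closed_of_finiteDimensional V).isClosedEmbedding_subtypeVal
  exact h.isCompact_preimage hX

theorem convex_slice (V : Submodule ℝ (Fin n → ℝ)) (v : Fin n → ℝ) {X : Set (Fin n → ℝ)}
    (hX : Convex ℝ X) : Convex ℝ (slice V v X) :=
  (hX.translate_preimage_left v).linear_preimage V.subtype

theorem slice_mono (V : Submodule ℝ (Fin n → ℝ)) (v : Fin n → ℝ) {X Y : Set (Fin n → ℝ)}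
    (h : X ⊆ Y) : slice V v X ⊆ slice V v Y := fun _ hu => h hu

theorem coneOver_slice_subset_span (V : Submodule ℝ (Fin n → ℝ)) (v : Fin n → ℝ)
    (X : Set (Fin n → ℝ)) : coneOver (slice V v X) ⊆ Submodule.span ℝ (slice V v X) := by
  rintro _ ⟨t, -, x, hx, rfl⟩
  exact Submodule.smul_mem _ _ (Submodule.subset_span hx)

variable {P : Set (Fin n → ℝ)} {v : Fin n → ℝ}

theorem sub_mem_direction (hv : v ∈ P) {x : Fin n → ℝ} (hx : x ∈ P) :
    x - v ∈ (affineSpan ℝ P).direction := by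
  rw [direction_affineSpan]
  exact vsub_mem_vectorSpan ℝ hx hv

theorem span_slice_eq_top (hv : v ∈ P) :
    Submodule.span ℝ (slice (affineSpan ℝ P).direction v P) = ⊤ := by
  set V := (affineSpan ℝ P).direction with hV
  have key : V ≤ (Submodule.span ℝ (slice V v P)).map V.subtype := by
    conv_lhs => rw [hV, direction_affineSpan, vectorSpan_eq_span_vsub_set_right ℝ hv]
    refine Submodule.span_le.2 ?_
    rintro _ ⟨x, hx, rfl⟩
    exact ⟨⟨x - v, sub_mem_direction hv hx⟩, Submodule.subset_span (by simpa [slice] using hx),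
      rfl⟩
  rw [eq_top_iff]
  rintro ⟨x, hx⟩ -
  obtain ⟨y, hy, hyx⟩ := key hx
  have : y = ⟨x, hx⟩ := Subtype.ext hyx
  exact this ▸ hy

theorem interior_slice_nonempty (hconv : Convex ℝ P) (hv : v ∈ P) :
    (interior (slice (affineSpan ℝ P).direction v P)).Nonempty := by
  have h0 : (0 : (affineSpan ℝ P).direction) ∈ slice (affineSpan ℝ P).direction v P := by
    simpa [slice] using hv
  rw [(convex_slice _ v hconv).interior_nonempty_iff_affineSpan_eq_top,
    AffineSubspace.affineSpan_eq_top_iff_vectorSpan_eq_top_of_nonempty _ _ _ ⟨0, h0⟩,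
    vectorSpan_eq_span_vsub_set_right ℝ h0]
  simpa using span_slice_eq_top hv

theorem affDim_eq_finrank_vectorSpan (X : Set (Fin n → ℝ)) :
    affDim X = finrank ℝ (vectorSpan ℝ X) := by
  rw [affDim, direction_affineSpan]

/-- A subset whose translate spans the ambient direction has codimension at most one. -/
theorem affDim_le_of_span_slice_eq_top {F : Set (Fin n → ℝ)} (hF : F.Nonempty)
    (htop : Submodule.span ℝ (slice (affineSpan ℝ P).direction v F) = ⊤) :
    affDim P ≤ affDim F + 1 := by
  set V := (affineSpan ℝ P).direction
  obtain ⟨f₀, hf₀⟩ := hF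
  have hle : V ≤ vectorSpan ℝ F ⊔ Submodule.span ℝ {f₀ - v} := by
    have h1 : V = (Submodule.span ℝ (slice V v F)).map V.subtype := by
      rw [htop, Submodule.map_top, Submodule.range_subtype]
    conv_lhs => rw [h1, Submodule.map_span]
    refine Submodule.span_le.2 ?_
    rintro _ ⟨u, hu, rfl⟩
    have h2 : V.subtype u = ((u : Fin n → ℝ) + v - f₀) + (f₀ - v) := by
      simp
    rw [h2]
    exact Submodule.add_mem_sup (vsub_mem_vectorSpan ℝ hu hf₀)
      (Submodule.mem_span_singleton_self _)
  calc affDim P ≤ finrank ℝ ↥(vectorSpan ℝ F ⊔ Submodule.span ℝ {f₀ - v}) :=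
        Submodule.finrank_mono hle
    _ ≤ finrank ℝ (vectorSpan ℝ F) + finrank ℝ (Submodule.span ℝ {f₀ - v}) :=
        Submodule.finrank_add_le_finrank_add_finrank _ _
    _ ≤ affDim F + 1 := by
        rw [affDim_eq_finrank_vectorSpan]
        gcongr
        simpa using finrank_span_le_card ({f₀ - v} : Set (Fin n → ℝ))

theorem span_slice_ne_top_of_mem {F : Set (Fin n → ℝ)} (hv : v ∈ F)
    (hdim : affDim F < affDim P) :
    Submodule.span ℝ (slice (affineSpan ℝ P).direction v F) ≠ ⊤ := by
  intro htop
  set V := (affineSpan ℝ P).direction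
  have hle : V ≤ vectorSpan ℝ F := by
    have h1 : V = (Submodule.span ℝ (slice V v F)).map V.subtype := by
      rw [htop, Submodule.map_top, Submodule.range_subtype]
    conv_lhs => rw [h1, Submodule.map_span]
    refine Submodule.span_le.2 ?_
    rintro _ ⟨u, hu, rfl⟩
    have h2 : V.subtype u = (u : Fin n → ℝ) + v - v := by simp
    rw [h2]
    exact vsub_mem_vectorSpan ℝ hu hv
  have := Submodule.finrank_mono hle
  rw [← affDim_eq_finrank_vectorSpan] at this
  exact absurd this (not_le.2 hdim)

/-- Every point of `P` other than `v` lies on a segment from `v` to a proper face. -/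
theorem exists_isExposed_mem_coneOver (hP : IsCompact P) (hconv : Convex ℝ P) (hv : v ∈ P)
    {u : (affineSpan ℝ P).direction} (hu : u ∈ slice (affineSpan ℝ P).direction v P)
    (hu0 : u ≠ 0) :
    ∃ F, F.Nonempty ∧ IsExposed ℝ P F ∧ affDim F < affDim P ∧
      u ∈ coneOver (slice (affineSpan ℝ P).direction v F) := by
  set V := (affineSpan ℝ P).direction with hVdef
  obtain ⟨f, p, hp, t, ht, htp, hmax, y, hy, hylt⟩ := exists_supporting_functional_of_mem
    (isCompact_slice V v hP) (convex_slice V v hconv) (interior_slice_nonempty hconv hv) hu hu0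
  obtain ⟨g, hg⟩ := LinearMap.exists_extend (f : V →ₗ[ℝ] ℝ)
  have hgf : ∀ u : V, g u = f u := fun u => LinearMap.congr_fun hg u
  let l : StrongDual ℝ (Fin n → ℝ) := LinearMap.toContinuousLinearMap g
  have hl : ∀ u : V, l ((u : Fin n → ℝ) + v) = f u + l v := by
    intro u
    rw [map_add]
    congr 1
    exact hgf u
  set F := {x ∈ P | ∀ y ∈ P, l y ≤ l x} with hFdef
  have hpF : (p : Fin n → ℝ) + v ∈ F := by
    refine ⟨hp, fun x hx => ?_⟩
    have h1 := hl ⟨x - v, sub_mem_direction hv hx⟩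
    have h2 := hmax ⟨x - v, sub_mem_direction hv hx⟩ (by simpa [slice] using hx)
    simp only [sub_add_cancel] at h1
    rw [hl, h1]
    gcongr
  refine ⟨F, ⟨_, hpF⟩, fun _ => ⟨l, rfl⟩, ?_, t, ht, p, hpF, htp⟩
  have hle : vectorSpan ℝ F ≤ V := by
    rw [hVdef, direction_affineSpan]
    exact vectorSpan_mono ℝ (Set.sep_subset _ _)
  have hne : vectorSpan ℝ F ≠ V := by
    intro h
    have hmem : (y : Fin n → ℝ) + v - (p + v) ∈ vectorSpan ℝ F := by
      rw [h]
      simpa using V.sub_mem y.2 p.2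
    have := vectorSpan_le_ker (l : (Fin n → ℝ) →ₗ[ℝ] ℝ)
      (fun a ha b hb => le_antisymm (hb.2 a ha.1) (ha.2 b hb.1)) hmem
    have h3 : l ((y : Fin n → ℝ) + v) = l (p + v) := by
      rw [LinearMap.mem_ker, map_sub, sub_eq_zero] at this
      exact this
    rw [hl, hl] at h3
    linarith
  rw [affDim_eq_finrank_vectorSpan]
  exact Submodule.finrank_lt_finrank_of_lt (lt_of_le_of_ne hle hne)

/-- Cones over distinct facets overlap in a set spanning a proper subspace. -/
theorem inter_coneOver_subset_span {F F' : Set (Fin n → ℝ)} (hF : IsExposed ℝ P F)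
    (hF' : IsExposed ℝ P F') (hv : v ∈ P) (hvF : v ∉ F) (hvF' : v ∉ F')
    (V : Submodule ℝ (Fin n → ℝ)) :
    coneOver (slice V v F) ∩ coneOver (slice V v F')
      ⊆ Submodule.span ℝ (slice V v (F ∩ F')) := by
  rintro u ⟨⟨t, ht, x, hx, rfl⟩, t', ht', x', hx', hxx'⟩
  obtain ⟨l, hl⟩ := hF.exists_functional_lt ⟨_, hx⟩ hv hvF
  obtain ⟨l', hl'⟩ := hF'.exists_functional_lt ⟨_, hx'⟩ hv hvF'
  have hxx : t' • (x' : Fin n → ℝ) = t • (x : Fin n → ℝ) := congrArg Subtype.val hxx'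
  -- `l` is positive on `x` and `l x' ≤ l x`, so `t * l x = t' * l x' ≤ t' * l x` gives `t ≤ t'`;
  -- `l'` gives the converse.
  have htt : t = t' := by
    have e1 := congrArg l hxx
    have e2 := congrArg l' hxx
    have h1 := (hl _ hx).1
    have h2 := (hl _ hx).2 _ (hF'.subset hx')
    have h3 := (hl' _ hx').1
    have h4 := (hl' _ hx').2 _ (hF.subset hx)
    simp only [map_add, map_smul, smul_eq_mul, lt_add_iff_pos_left, add_le_add_iff_right] at *
    apply le_antisymm
    · by_contra! hlt
      nlinarith [mul_le_mul_of_nonneg_left h2 ht'.1]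
    · by_contra! hlt
      nlinarith [mul_le_mul_of_nonneg_left h4 ht.1]
  subst htt
  rcases eq_or_ne t 0 with rfl | h0
  · simp
  · have hx_eq : x' = x := smul_right_injective V h0 hxx'
    refine Submodule.smul_mem _ _ (Submodule.subset_span ⟨hx, ?_⟩)
    exact hx_eq ▸ hx'

/-- Otherwise `F ∩ F'` would have the dimension, hence the vector span, of both facets. Each is cut
out of `P` by its affine hull, so they would coincide. An empty intersection is excluded by `1 ≤
affDim P`. -/
theorem span_slice_inter_ne_top (hdim : 1 ≤ affDim P) {F F' : Set (Fin n → ℝ)}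
    (hF : F ∈ facets P) (hF' : F' ∈ facets P) (hne : F ≠ F') :
    Submodule.span ℝ (slice (affineSpan ℝ P).direction v (F ∩ F')) ≠ ⊤ := by
  intro htop
  rcases (F ∩ F').eq_empty_or_nonempty with h | ⟨p, hp⟩
  · rw [h] at htop
    have h0 : slice (affineSpan ℝ P).direction v ∅ = ∅ := rfl
    rw [h0, Submodule.span_empty] at htop
    have := finrank_top ℝ (affineSpan ℝ P).direction
    rw [← htop, finrank_bot] at this
    rw [affDim, ← this] at hdim
    omega
  · have h1 := affDim_le_of_span_slice_eq_top ⟨p, hp⟩ htop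
    have key : ∀ G ∈ facets P, F ∩ F' ⊆ G → vectorSpan ℝ (F ∩ F') = vectorSpan ℝ G := by
      intro G hG hsub
      refine Submodule.eq_of_le_of_finrank_le (vectorSpan_mono ℝ hsub) ?_
      rw [← affDim_eq_finrank_vectorSpan, ← affDim_eq_finrank_vectorSpan]
      have := hG.2.2
      omega
    have hvs : vectorSpan ℝ F = vectorSpan ℝ F' :=
      (key F hF Set.inter_subset_left).symm.trans (key F' hF' Set.inter_subset_right)
    apply hne
    ext x
    constructor
    · intro hx
      rw [hF'.2.1.mem_iff_sub_mem_vectorSpan hp.2 (hF.2.1.subset hx), ← hvs]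
      exact vsub_mem_vectorSpan ℝ hx hp.1
    · intro hx
      rw [hF.2.1.mem_iff_sub_mem_vectorSpan hp.1 (hF'.2.1.subset hx), hvs]
      exact vsub_mem_vectorSpan ℝ hx hp.2

/-- The volume of a polytope is the sum of the volumes of the pyramids with apex `v` over its
facets. -/
theorem measure_slice_eq_sum (hP : IsCompact P) (hconv : Convex ℝ P)
    (hfin : (P.extremePoints ℝ).Finite) (hdim : 1 ≤ affDim P) (hv : v ∈ P)
    (μ : Measure (affineSpan ℝ P).direction) [μ.IsAddHaarMeasure] (s : Finset (Set (Fin n → ℝ)))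
    (hs : ∀ F, F ∈ s ↔ F ∈ facets P) :
    μ (slice (affineSpan ℝ P).direction v P)
      = ∑ F ∈ s, μ (coneOver (slice (affineSpan ℝ P).direction v F)) := by
  let V := (affineSpan ℝ P).direction
  have hfaces := finite_setOf_isExposed hP hconv hfin
  have hnull : ∀ N : Submodule ℝ V, N ≠ ⊤ → μ N = 0 := fun N hN => Measure.addHaar_submodule μ N hN
  rw [← measure_biUnion_finset₀]
  · apply measure_congr
    -- A finite union of proper subspaces, containing every cone over a face whose translate does
    -- not span.
    set B : Set V := ⋃ F ∈ {F | IsExposed ℝ P F ∧ Submodule.span ℝ (slice V v F) ≠ ⊤},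
      (Submodule.span ℝ (slice V v F) : Set V)
    have hB : μ B = 0 := by
      refine (measure_biUnion_null_iff (hfaces.subset fun F hF => hF.1).countable).2 ?_
      exact fun F hF => hnull _ hF.2
    have h0 : μ {(0 : V)} = 0 := by
      have hbot : (⊥ : Submodule ℝ V) ≠ ⊤ := by
        intro h
        have := finrank_top ℝ V
        rw [← h, finrank_bot] at this
        exact absurd hdim (by rw [affDim, ← this]; omega)
      simpa using hnull ⊥ hbot
    refine Filter.EventuallyLE.antisymm ?_ (LE.le.eventuallyLE ?_)
    · rw [ae_le_set]
      refine measure_mono_null (t := B ∪ {0}) ?_ (measure_union_null hB h0)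
      rintro u ⟨hu, hus⟩
      by_cases hu0 : u = 0
      · exact Or.inr hu0
      left
      obtain ⟨F, hFne, hF, hFdim, huF⟩ := exists_isExposed_mem_coneOver hP hconv hv hu hu0
      by_cases htop : Submodule.span ℝ (slice V v F) = ⊤
      · have h1 := affDim_le_of_span_slice_eq_top hFne htop
        have hFs : F ∈ s := (hs F).2 ⟨hFne, hF, by omega⟩
        exact absurd (Set.mem_biUnion (Finset.mem_coe.2 hFs) huF) hus
      · exact Set.mem_biUnion (show F ∈ {F | _ ∧ _} from ⟨hF, htop⟩)
          (coneOver_slice_subset_span V v F huF)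
    · refine Set.iUnion₂_subset fun F hF => ?_
      exact coneOver_subset (convex_slice V v hconv) (by simpa [slice] using hv)
        (slice_mono V v ((hs F).1 hF).2.1.subset)
  · intro F hFs F' hFs' hne
    have hF := (hs F).1 hFs
    have hF' := (hs F').1 hFs'
    have hmem : ∀ G ∈ facets P, v ∈ G → μ (coneOver (slice V v G)) = 0 := fun G hG hvG =>
      measure_mono_null (coneOver_slice_subset_span V v G)
        (hnull _ (span_slice_ne_top_of_mem hvG (by have := hG.2.2; omega)))
    by_cases hvF : v ∈ F
    · exact measure_mono_null Set.inter_subset_left (hmem F hF hvF)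
    by_cases hvF' : v ∈ F'
    · exact measure_mono_null Set.inter_subset_right (hmem F' hF' hvF')
    exact measure_mono_null (inter_coneOver_subset_span hF.2.1 hF'.2.1 hv hvF hvF' V)
      (hnull _ (span_slice_inter_ne_top hdim hF hF' hne))
  · intro F hF
    exact (isCompact_coneOver (isCompact_slice V v
      (((hs F).1 hF).2.1.isCompact hP))).measurableSet.nullMeasurableSet

end Slice

/-! ### Primitive integral forms and lattice heights -/

/-- A rational subspace of codimension one in a rational subspace is the kernel of a primitive
integral linear form. -/
theorem IsRationalSubspace.exists_primitive_form {n : ℕ} {V W : Submodule ℝ (Fin n → ℝ)}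
    (hV : IsRationalSubspace V) (hW : IsRationalSubspace W) (hWV : W ≤ V)
    (hdim : finrank ℝ W + 1 = finrank ℝ V) :
    ∃ φ : (Fin n → ℝ) →ₗ[ℝ] ℝ, (∀ z ∈ latticeOf V, ∃ m : ℤ, φ (intVec z) = m) ∧
      (∃ z ∈ latticeOf V, φ (intVec z) = 1) ∧ ∀ y ∈ V, y ∈ W ↔ φ y = 0 := by
  let incl := Submodule.inclusion (latticeOf_mono hWV)
  let N : Submodule ℤ (latticeOf V) := LinearMap.range incl
  have hN : ∀ z : latticeOf V, z ∈ N ↔ intVec (z : Fin n → ℤ) ∈ W := by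
    intro z
    constructor
    · rintro ⟨w, rfl⟩
      exact w.2
    · intro h
      exact ⟨⟨z, h⟩, rfl⟩
  -- The lattice of `W` is saturated: `m • z ∈ W` with `m ≠ 0` forces `z ∈ W`. The quotient is thus
  -- free of rank one, and an isomorphism with `ℤ` yields a surjective, hence primitive, form.
  have htf : IsTorsionFree ℤ (latticeOf V ⧸ N) := by
    refine Module.IsTorsionFree.of_smul_eq_zero fun m q h => ?_
    obtain ⟨z, rfl⟩ := N.mkQ_surjective q
    rw [← map_smul, Submodule.mkQ_apply, Submodule.Quotient.mk_eq_zero, hN] at h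
    rw [Submodule.mkQ_apply, Submodule.Quotient.mk_eq_zero, hN]
    by_cases hm : m = 0
    · exact Or.inl hm
    · right
      have h1 : intVec ((m • z : latticeOf V) : Fin n → ℤ) = (m : ℝ) • intVec (z : Fin n → ℤ) := by
        ext i
        simp [intVec]
      rw [h1] at h
      exact (W.smul_mem_iff (by exact_mod_cast hm)).1 h
  have hfree : Module.Free ℤ (latticeOf V ⧸ N) := Module.free_of_finite_type_torsion_free'
  have hrank : finrank ℤ (latticeOf V ⧸ N) = 1 := by
    have h1 := Submodule.finrank_quotient_add_finrank N
    have h2 : finrank ℤ N = finrank ℤ (latticeOf W) :=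
      LinearMap.finrank_range_of_inj (Submodule.inclusion_injective _)
    rw [h2, hW.finrank_latticeOf, hV.finrank_latticeOf] at h1
    omega
  obtain ⟨e⟩ := nonempty_linearEquiv_of_finrank_eq_one hrank
  let ψ : latticeOf V →ₗ[ℤ] ℤ := e.symm.toLinearMap.comp N.mkQ
  let b := Module.finBasis ℤ (latticeOf V)
  obtain ⟨φ, hφ⟩ := LinearMap.exists_extend
    ((hV.realBasis b).constr ℝ (fun i => (ψ (b i) : ℝ)))
  have hφψ : ∀ z : latticeOf V, φ (intVec z) = ψ z := by
    have h : (φ.restrictScalars ℤ).comp ((V.subtype.restrictScalars ℤ).comp (latticeEmb V))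
        = (Algebra.linearMap ℤ ℝ).comp ψ := by
      refine b.ext fun i => ?_
      have h1 := LinearMap.congr_fun hφ (latticeEmb V (b i))
      rw [← hV.realBasis_apply, Basis.constr_basis] at h1
      rw [hV.realBasis_apply] at h1
      simpa using h1
    exact fun z => LinearMap.congr_fun h z
  have hWker : W ≤ LinearMap.ker φ := by
    have h1 : Submodule.span ℝ (Set.range (latticeEmb W)) ≤ LinearMap.ker (φ.comp W.subtype) := by
      refine Submodule.span_le.2 ?_
      rintro _ ⟨w, rfl⟩
      have h2 : φ (intVec w) = ψ (incl w) := hφψ (incl w)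
      have h3 : ψ (incl w) = 0 := by
        have : N.mkQ (incl w) = 0 := (Submodule.Quotient.mk_eq_zero _).2 ⟨w, rfl⟩
        simp only [ψ, LinearMap.comp_apply, this, map_zero]
      rw [h3] at h2
      simpa [coe_latticeEmb] using h2
    rw [show Submodule.span ℝ (Set.range (latticeEmb W)) = ⊤ from hW] at h1
    intro w hw
    exact h1 (Submodule.mem_top (x := (⟨w, hw⟩ : W)))
  obtain ⟨z₀, hz₀⟩ : ∃ z, ψ z = 1 := (e.symm.surjective.comp N.mkQ_surjective) 1
  have hz₀' : φ (intVec z₀) = 1 := by rw [hφψ, hz₀]; simp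
  have hker : W = V ⊓ LinearMap.ker φ := by
    refine Submodule.eq_of_le_of_finrank_le (le_inf hWV hWker) ?_
    have hlt : V ⊓ LinearMap.ker φ < V := by
      refine lt_of_le_of_ne inf_le_left fun h => ?_
      have : intVec (z₀ : Fin n → ℤ) ∈ V ⊓ LinearMap.ker φ := h.ge z₀.2
      have h0 := LinearMap.mem_ker.1 this.2
      rw [hz₀'] at h0
      exact one_ne_zero h0
    have := Submodule.finrank_lt_finrank_of_lt hlt
    omega
  refine ⟨φ, fun z hz => ⟨_, hφψ ⟨z, hz⟩⟩, ⟨z₀, z₀.2, hz₀'⟩, fun y hy => ?_⟩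
  rw [hker]
  simp [hy]

section Height

variable {n : ℕ} {P F : Set (Fin n → ℝ)} {v : Fin n → ℝ}

/-- Adding a point outside `aff F` raises the dimension by at least one, which already exhausts `dim
P`. -/
theorem affineSpan_insert_facet (hF : F ∈ facets P) (hv : v ∈ P) (hvF : v ∉ affineSpan ℝ F) :
    affineSpan ℝ (insert v (affineSpan ℝ F : Set (Fin n → ℝ))) = affineSpan ℝ P := by
  obtain ⟨f₀, hf₀⟩ := hF.1
  have hle : affineSpan ℝ (insert v (affineSpan ℝ F : Set (Fin n → ℝ))) ≤ affineSpan ℝ P := by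
    refine affineSpan_le.2 (Set.insert_subset (mem_affineSpan ℝ hv) ?_)
    exact affineSpan_mono ℝ hF.2.1.subset
  have hf₀' : f₀ ∈ affineSpan ℝ (insert v (affineSpan ℝ F : Set (Fin n → ℝ))) :=
    mem_affineSpan ℝ (Set.mem_insert_of_mem _ (mem_affineSpan ℝ hf₀))
  have hlt : affineSpan ℝ F < affineSpan ℝ (insert v (affineSpan ℝ F : Set (Fin n → ℝ))) := by
    refine lt_of_le_of_ne ?_ fun h => ?_
    · exact fun x hx => mem_affineSpan ℝ (Set.mem_insert_of_mem _ hx)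
    · exact hvF (h ▸ mem_affineSpan ℝ (Set.mem_insert _ _))
  have hdir := AffineSubspace.direction_lt_of_nonempty hlt ⟨f₀, mem_affineSpan ℝ hf₀⟩
  have hrank := Submodule.finrank_lt_finrank_of_lt hdir
  refine AffineSubspace.eq_of_direction_eq_of_nonempty_of_le ?_ ⟨f₀, hf₀'⟩ hle
  refine Submodule.eq_of_le_of_finrank_le (AffineSubspace.direction_le hle) ?_
  have := hF.2.2
  rw [affDim, affDim] at this
  omega

theorem exists_isLatticeHeight (hF : F ∈ facets P) (hv : v ∈ P)
    (hPr : IsRationalSubspace (affineSpan ℝ P).direction)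
    (hFr : IsRationalSubspace (affineSpan ℝ F).direction) :
    ∃ r, IsLatticeHeight (affineSpan ℝ F) v r := by
  by_cases hvF : v ∈ affineSpan ℝ F
  · exact ⟨0, Or.inl ⟨hvF, rfl⟩⟩
  obtain ⟨f₀, hf₀⟩ := hF.1
  have hf₀F : f₀ ∈ affineSpan ℝ F := mem_affineSpan ℝ hf₀
  have hle : affineSpan ℝ F ≤ affineSpan ℝ P := affineSpan_mono ℝ hF.2.1.subset
  obtain ⟨φ, h1, h2, h3⟩ := hPr.exists_primitive_form hFr (AffineSubspace.direction_le hle) hF.2.2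
  refine ⟨|φ (v - f₀) - 0|, Or.inr ⟨hvF, ?_⟩⟩
  rw [affineSpan_insert_facet hF hv hvF]
  refine ⟨f₀, hle hf₀F, φ, 0, h1, h2, fun y hy => ?_, rfl⟩
  have h4 := h3 (y - f₀) (AffineSubspace.vsub_mem_direction hy (hle hf₀F))
  exact (AffineSubspace.vsub_right_mem_direction_iff_mem hf₀F y).symm.trans h4

theorem isLatticeHeight_latticeHeight (hF : F ∈ facets P) (hv : v ∈ P)
    (hPr : IsRationalSubspace (affineSpan ℝ P).direction)
    (hFr : IsRationalSubspace (affineSpan ℝ F).direction) :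
    IsLatticeHeight (affineSpan ℝ F) v (latticeHeight F v) := by
  have h := exists_isLatticeHeight hF hv hPr hFr
  rw [latticeHeight, dif_pos h]
  exact h.choose_spec

/-- The volume of the pyramid with apex `v` over a facet. -/
theorem latticeMeasure_coneOver_facet (hP : IsCompact P) (hF : F ∈ facets P) (hv : v ∈ P)
    (hPr : IsRationalSubspace (affineSpan ℝ P).direction)
    (hFr : IsRationalSubspace (affineSpan ℝ F).direction) :
    (latticeMeasure (affineSpan ℝ P).direction
        (coneOver (slice (affineSpan ℝ P).direction v F))).toReal
      = latticeHeight F v * latticeVolume F := by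
  have hle : affineSpan ℝ F ≤ affineSpan ℝ P := affineSpan_mono ℝ hF.2.1.subset
  rcases isLatticeHeight_latticeHeight hF hv hPr hFr with ⟨hvH, hr⟩ | ⟨hvH, h⟩
  -- At height zero `v` lies in `P ∩ aff F = F`, so the cone sits in a proper subspace and both
  -- sides vanish.
  · have hvF : v ∈ F := by
      obtain ⟨f₀, hf₀⟩ := hF.1
      rw [hF.2.1.mem_iff_sub_mem_vectorSpan hf₀ hv, ← direction_affineSpan]
      exact AffineSubspace.vsub_mem_direction hvH (mem_affineSpan ℝ hf₀)
    have h0 : (Measure.addHaar : Measure (affineSpan ℝ P).direction)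
        (coneOver (slice (affineSpan ℝ P).direction v F)) = 0 :=
      measure_mono_null (coneOver_slice_subset_span _ v F) (Measure.addHaar_submodule _ _
        (span_slice_ne_top_of_mem hvF (by have := hF.2.2; omega)))
    rw [hr, latticeMeasure, Measure.smul_apply, h0]
    simp
  · rw [affineSpan_insert_facet hF hv hvH] at h
    obtain ⟨w, hw, φ, β, h1, ⟨z₀, hz₀, hz₀'⟩, h3, hr⟩ := h
    rw [latticeVolume, dif_pos hF.1]
    have hf₀ := hF.1.some_mem
    set f₀ := hF.1.some
    have hf₀F : f₀ ∈ affineSpan ℝ F := mem_affineSpan ℝ hf₀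
    have hβ : φ (f₀ - w) = β := (h3 _ (hle hf₀F)).1 hf₀F
    -- Whatever `w`, `φ` and `β` witness the height, the linear part of the equation cuts out the
    -- direction of `F`; the chosen height therefore always equals `|φ (f₀ - v)|`.
    have hW : ∀ y ∈ (affineSpan ℝ P).direction, y ∈ (affineSpan ℝ F).direction ↔ φ y = 0 := by
      intro y hy
      have hy' : y + f₀ ∈ affineSpan ℝ P := AffineSubspace.vadd_mem_of_mem_direction hy (hle hf₀F)
      have h4 := h3 _ hy'
      rw [add_sub_assoc, map_add, hβ, add_eq_right] at h4
      rw [← h4]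
      exact (AffineSubspace.vadd_mem_iff_mem_direction y hf₀F).symm
    have hpyr := hPr.latticeMeasure_pyramid (AffineSubspace.direction_le hle) φ h1 ⟨z₀, hz₀⟩ hz₀'
      hW (isCompact_slice (affineSpan ℝ F).direction f₀ (hF.2.1.isCompact hP))
      ⟨f₀ - v, sub_mem_direction hv (hF.2.1.subset hf₀)⟩
    have hslice : (fun g => (⟨f₀ - v, sub_mem_direction hv (hF.2.1.subset hf₀)⟩ :
          (affineSpan ℝ P).direction) + Submodule.inclusion (AffineSubspace.direction_le hle) g) ''
          slice (affineSpan ℝ F).direction f₀ F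
        = slice (affineSpan ℝ P).direction v F := by
      ext u
      constructor
      · rintro ⟨g, hg, rfl⟩
        have h5 : f₀ - v + (g : Fin n → ℝ) + v = g + f₀ := by abel
        simpa [slice, h5] using hg
      · intro hu
        refine ⟨⟨u + v - f₀, ?_⟩, ?_, ?_⟩
        · exact AffineSubspace.vsub_mem_direction (mem_affineSpan ℝ hu) hf₀F
        · simpa [slice] using hu
        · apply Subtype.ext
          simp only [Submodule.coe_add, Submodule.coe_inclusion]
          abel
    rw [hslice] at hpyr
    rw [hpyr, ENNReal.toReal_mul, ENNReal.toReal_ofReal (abs_nonneg _), hr]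
    have h6 : φ (v - w) - β = - φ (f₀ - v) := by
      rw [← hβ, ← map_sub, ← map_neg]
      congr 1
      abel
    rw [h6, abs_neg]
    rfl

/-- The volume of `X` may be computed with respect to any base point. -/
theorem latticeVolume_eq_slice (hv : v ∈ P) :
    latticeVolume P = (latticeMeasure (affineSpan ℝ P).direction
      (slice (affineSpan ℝ P).direction v P)).toReal := by
  have hne : P.Nonempty := ⟨v, hv⟩
  rw [latticeVolume, dif_pos hne, latticeMeasure, Measure.smul_apply, Measure.smul_apply]
  congr 2
  have h : {u : (affineSpan ℝ P).direction | (u : Fin n → ℝ) + hne.some ∈ P}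
      = (fun u => u + ⟨hne.some - v, sub_mem_direction hv hne.some_mem⟩) ⁻¹'
        slice (affineSpan ℝ P).direction v P := by
    ext u
    have h1 : (u : Fin n → ℝ) + (hne.some - v) + v = u + hne.some := by abel
    simp [slice, h1]
  rw [h, measure_preimage_add_right]

end Height

theorem proposition2p1 (n : ℕ) (P : Set (Fin n → ℝ)) (hP : IsRationalPolytope P)
    (hdim : 1 ≤ affDim P) (v : Fin n → ℝ) (hv : v ∈ P) :
    (facets P).Finite ∧
      latticeVolume P = ∑ᶠ F ∈ facets P, latticeHeight F v * latticeVolume F := by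
  obtain ⟨⟨S, hS, hPS⟩, hrat⟩ := hP
  have hcomp : IsCompact P := hPS ▸ hS.isCompact_convexHull (𝕜 := ℝ)
  have hconv : Convex ℝ P := hPS ▸ convex_convexHull ℝ S
  have hfin : (P.extremePoints ℝ).Finite :=
    hS.subset (hPS ▸ extremePoints_convexHull_subset)
  have hfac : (facets P).Finite :=
    (finite_setOf_isExposed hcomp hconv hfin).subset fun F hF => hF.2.1
  have hrational : ∀ F, IsExposed ℝ P F → IsRationalSubspace (affineSpan ℝ F).direction := by
    intro F hF
    -- A face is the hull of vertices of `P`, so its direction is spanned by differences of rational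
    -- points.
    rw [← hF.convexHull_extremePoints hcomp hconv hfin, affineSpan_convexHull,
      direction_affineSpan]
    exact isRationalSubspace_vectorSpan fun x hx => hrat x hx.2
  have hPr := hrational P (IsExposed.refl P)
  refine ⟨hfac, ?_⟩
  have hsum := measure_slice_eq_sum hcomp hconv hfin hdim hv Measure.addHaar hfac.toFinset
    (fun F => hfac.mem_toFinset)
  have hlsum : latticeMeasure (affineSpan ℝ P).direction (slice (affineSpan ℝ P).direction v P)
      = ∑ F ∈ hfac.toFinset, latticeMeasure (affineSpan ℝ P).direction
        (coneOver (slice (affineSpan ℝ P).direction v F)) := by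
    simp only [latticeMeasure, Measure.smul_apply, smul_eq_mul]
    rw [hsum, Finset.mul_sum]
  rw [latticeVolume_eq_slice hv, hlsum, finsum_mem_eq_finite_toFinset_sum _ hfac,
    ENNReal.toReal_sum]
  · refine Finset.sum_congr rfl fun F hF => ?_
    have hF' := hfac.mem_toFinset.1 hF
    exact latticeMeasure_coneOver_facet hcomp hF' hv hPr (hrational F hF'.2.1)
  · intro F hF
    have hF' := hfac.mem_toFinset.1 hF
    rw [latticeMeasure, Measure.smul_apply]
    exact ENNReal.mul_ne_top (ENNReal.inv_ne_top.2 (hPr.measure_unimodularSimplex_ne_zero _))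
      (isCompact_coneOver (isCompact_slice _ v (hF'.2.1.isCompact hcomp))).measure_lt_top.ne
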